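/- Let $\mathbb{R}_\infty=\mathbb{R}\cup\{\infty\}$ be the tropical semiring with $\oplus=\min$ and $\otimes=+$. A tropical polynomial $f=\bigoplus_{e} a_e\otimes x^{\otimes e}$ in variables $x_1,\dots,x_m$ is a finite collection of monomials $Q_e(x)=a_e+\sum_i e_i x_i$ with pairwise distinct exponents $e\in\mathbb{Z}_{\ge 0}^m$ and coefficients $a_e\in\mathbb{R}_\infty$; a monomial with $a_e=\infty$ counts as absent. The tropical hypersurface of $f$ is the set of all $x\in\mathbb{R}^m$ such that $\min_e Q_e(x)$ is finite and attained for at least two different exponents $e$, or $Q_e(x)=\infty$ for all $e$. The tropical prevariety given by a finite system of tropical polynomials is the intersection of their hypersurfaces (it is $\mathbb{R}^m$ for the empty system). **Theorem.** Let $A$ be a finite system of tropical polynomials in $n$ variables $x_1,\dots,x_n$, and let $V\subset\mathbb{R}^n$ be the tropical prevariety given by $A$. Then one can add $2n$ new variables $y_1,\dots,y_{2n}$ and $4n$ tropical polynomials of tropical degree $1$ (linear, with infinite coefficients allowed) in the $3n$ variables $x_1,\dots,x_n,y_1,\dots,y_{2n}$ such that the system $B$, consisting of $A$ (viewed in the $3n$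 variables) and of the $4n$ added polynomials, determines a compact tropical prevariety $W\subset\mathbb{R}^{3n}$ that is homotopy equivalent to $V$. Moreover, the added polynomials can be chosen so that, for some real $s>0$, the projection $(x,y)\mapsto x$ restricts to a homeomorphism from $W$ onto $V\cap[-s,s]^n$. -/

import Mathlib

/-- Tropical polynomials in the variables `σ`: polynomials over the tropical semiring
`ℝ ∪ {∞}` with `⊕ = min` and `⊗ = +`. The zero of this semiring is `∞`, so the monomials in the
support are those with a finite coefficient; absent monomials have coefficient `∞`. -/
abbrev TropicalPolynomial (σ : Type*) : Type _ := MvPolynomial σ (Tropical (WithTop ℝ))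

namespace TropicalPolynomial

/-- The value `a_e + ∑ i, e_i x_i` at the point `x` of the monomial of `f` with exponent `e`
(`∞` if that monomial is absent). -/
noncomputable def monomialValue {σ : Type*} (f : TropicalPolynomial σ) (x : σ → WithTop ℝ)
    (e : σ →₀ ℕ) : WithTop ℝ :=
  Tropical.untrop (f.coeff e) + e.sum fun i m => m • x i

/-- `x` is a tropical zero of `f`: either all monomials of `f` are `∞` at `x`, or the minimum of
the monomials of `f` at `x` is finite and is attained by at least two different monomials. -/
def IsTropicalZero {σ : Type*} (f : TropicalPolynomial σ) (x : σ → WithTop ℝ) : Prop :=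
  (∀ e ∈ f.support, f.monomialValue x e = ⊤) ∨
    ∃ e₁ ∈ f.support, ∃ e₂ ∈ f.support, e₁ ≠ e₂ ∧
      f.monomialValue x e₁ ≠ ⊤ ∧ f.monomialValue x e₁ = f.monomialValue x e₂ ∧
      ∀ e ∈ f.support, f.monomialValue x e₁ ≤ f.monomialValue x e

/-- The tropical hypersurface of `f`: its tropical zeros with finite coordinates. -/
def hypersurface {σ : Type*} (f : TropicalPolynomial σ) : Set (σ → ℝ) :=
  {x | f.IsTropicalZero fun i => (x i : WithTop ℝ)}

end TropicalPolynomial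

/-- The tropical prevariety determined by a finite system of tropical polynomials. -/
def tropicalPrevariety {σ ι : Type*} [Finite ι] (A : ι → TropicalPolynomial σ) : Set (σ → ℝ) :=
  ⋂ i, (A i).hypersurface

/-- The system `A` in the variables `σ`, viewed as a system in the variables `σ ⊕ τ`, together
with the further polynomials `G` in these variables. -/
noncomputable def extendedSystem {σ τ ι κ : Type*} (A : ι → TropicalPolynomial σ)
    (G : κ → TropicalPolynomial (σ ⊕ τ)) : ι ⊕ κ → TropicalPolynomial (σ ⊕ τ) :=
  Sum.elim (fun i => MvPolynomial.rename Sum.inl (A i)) G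

/-- The cube `[-s, s]^n` in `ℝ^n`. -/
def centeredCube (n : ℕ) (s : ℝ) : Set (Fin n → ℝ) :=
  {x | ∀ i, -s ≤ x i ∧ x i ≤ s}

/-! The order in which the monomials of each polynomial of `A` occur at `x` decides whether `x` lies
in `V`. Weak inequalities between monomials cut out a convex cell around `x`, and this cell stays in
`V`. Only finitely many sign types occur, so finitely many points `S` represent them all. Averaging
the points of `S` in the cell of `x`, with weights continuous in `x`, gives a map `r` that moves
each `x` inside its cell. The straight-line homotopy to `r` shows that `V ∩ C` is homotopy
equivalent to `V` for every convex `C` containing `S` (`exists_finset_homotopyEquiv_inter_convex`).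

Taking a large cube for `C`, four linear polynomials per coordinate encode its two bounds and fix
the two new variables, so that `W` is the graph of a continuous map over `V ∩ C`. -/

/-! ### Convex cells and the averaging map -/

/-- The cell of `x` with respect to the functions `ℓ`: the points at which every `ℓ j` that is
nonnegative at `x` is nonnegative. -/
def signCell {E J : Type*} (ℓ : J → E → ℝ) (x : E) : Set E :=
  {z | ∀ j, 0 ≤ ℓ j x → 0 ≤ ℓ j z}

theorem mem_signCell_self {E J : Type*} (ℓ : J → E → ℝ) (x : E) : x ∈ signCell ℓ x :=
  fun _ h => h

theorem convex_signCell {E J : Type*} [AddCommGroup E] [Module ℝ E] {ℓ : J → E → ℝ}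
    (hℓ : ∀ j, ConcaveOn ℝ Set.univ (ℓ j)) (x : E) : Convex ℝ (signCell ℓ x) := by
  intro a ha b hb s t hs ht hst j hj
  have h := (hℓ j).2 (Set.mem_univ a) (Set.mem_univ b) hs ht hst
  have h1 := mul_nonneg hs (ha j hj)
  have h2 := mul_nonneg ht (hb j hj)
  simp only [smul_eq_mul] at h
  linarith

/-- A continuous function of `x` that is positive exactly where `p` lies in the cell of `x`. -/
noncomputable def cellWeight {E J : Type*} [Fintype J] (ℓ : J → E → ℝ) (p x : E) : ℝ :=
  ∏ j, if ℓ j p < 0 then max 0 (-ℓ j x) else 1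

theorem cellWeight_nonneg {E J : Type*} [Fintype J] (ℓ : J → E → ℝ) (p x : E) :
    0 ≤ cellWeight ℓ p x := by
  refine Finset.prod_nonneg fun j _ => ?_
  split_ifs
  · exact le_max_left _ _
  · exact zero_le_one

/-- The factor at `j` vanishes exactly when `ℓ j p < 0 ≤ ℓ j x`, that is, when `j` witnesses that
`p` is outside the cell. -/
theorem cellWeight_pos_iff {E J : Type*} [Fintype J] (ℓ : J → E → ℝ) (p x : E) :
    0 < cellWeight ℓ p x ↔ p ∈ signCell ℓ x := by
  constructor
  · intro h j hj
    by_contra hp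
    rw [not_le] at hp
    refine h.ne' (Finset.prod_eq_zero (Finset.mem_univ j) ?_)
    rw [if_pos hp, max_eq_left (by linarith)]
  · intro h
    refine Finset.prod_pos fun j _ => ?_
    split_ifs with hp
    · refine lt_max_of_lt_right ?_
      by_contra hx
      exact absurd (h j (by linarith)) (not_le.2 hp)
    · exact zero_lt_one

theorem continuous_cellWeight {E J : Type*} [TopologicalSpace E] [Fintype J] {ℓ : J → E → ℝ}
    (hℓ : ∀ j, Continuous (ℓ j)) (p : E) : Continuous (cellWeight ℓ p) := by
  refine continuous_finsetProd _ fun j _ => ?_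
  split_ifs
  · exact continuous_const.max (hℓ j).neg
  · exact continuous_const

/-- Every set has a finite subset that meets all the sign types occurring in it. -/
theorem exists_finset_cell_representatives {E J : Type*} [Finite J] (ℓ : J → E → ℝ) (V : Set E) :
    ∃ S : Finset E, ↑S ⊆ V ∧ ∀ x ∈ V, ∃ p ∈ S, p ∈ signCell ℓ x := by
  let f : E → Set J := fun x => {j | ℓ j x < 0}
  -- One representative per value of `f`; there are finitely many values because `Set J` is finite.
  obtain ⟨S, hSV, hS⟩ := Set.exists_subset_bijOn V f
  have hfin : S.Finite := (Set.toFinite (f '' V)).of_injOn hS.mapsTo hS.injOn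
  refine ⟨hfin.toFinset, by simpa using hSV, fun x hx => ?_⟩
  obtain ⟨p, hp, hpx⟩ := hS.surjOn (Set.mem_image_of_mem f hx)
  refine ⟨p, hfin.mem_toFinset.2 hp, fun j hj => ?_⟩
  by_contra hlt
  have : j ∈ f x := hpx ▸ (not_le.1 hlt : j ∈ f p)
  exact absurd hj (not_le.2 this)

/-- Maps into a subset `U` of a real vector space are homotopic if the segments between their
values lie in `U`. -/
theorem homotopic_of_segment_subset {X E : Type*} [TopologicalSpace X] [AddCommGroup E]
    [Module ℝ E] [TopologicalSpace E] [ContinuousAdd E] [ContinuousSMul ℝ E] {U : Set E}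
    (f g : C(X, U)) (h : ∀ x, segment ℝ (f x : E) (g x) ⊆ U) : f.Homotopic g := by
  have hmem : ∀ q : unitInterval × X,
      (1 - (q.1 : ℝ)) • (f q.2 : E) + (q.1 : ℝ) • (g q.2 : E) ∈ U := fun q =>
    h q.2 ⟨_, _, sub_nonneg.2 q.1.2.2, q.1.2.1, sub_add_cancel _ _, rfl⟩
  refine ⟨⟨⟨fun q => ⟨_, hmem q⟩, ?_⟩, fun x => ?_, fun x => ?_⟩⟩
  · refine Continuous.subtype_mk ?_ _
    fun_prop
  · simp
  · simp

/-- If a set `V` is a union of cells, there are finitely many points such that `V` is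
homotopy equivalent to its intersection with any convex set that contains these points. -/
theorem exists_finset_homotopyEquiv_inter_convex {E J : Type*} [AddCommGroup E] [Module ℝ E]
    [TopologicalSpace E] [ContinuousAdd E] [ContinuousSMul ℝ E] [Finite J]
    {ℓ : J → E → ℝ} (hcont : ∀ j, Continuous (ℓ j)) (hconc : ∀ j, ConcaveOn ℝ Set.univ (ℓ j))
    {V : Set E} (hV : ∀ x ∈ V, signCell ℓ x ⊆ V) :
    ∃ S : Finset E, ∀ C : Set E, Convex ℝ C → ↑S ⊆ C →
      Nonempty (ContinuousMap.HomotopyEquiv ↥(V ∩ C) ↥V) := by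
  have := Fintype.ofFinite J
  obtain ⟨S, -, hS⟩ := exists_finset_cell_representatives ℓ V
  refine ⟨S, fun C hC hSC => ?_⟩
  have hsum : ∀ x ∈ V, 0 < ∑ p ∈ S, cellWeight ℓ p x := fun x hx => by
    obtain ⟨p, hp, hpx⟩ := hS x hx
    exact Finset.sum_pos' (fun p _ => cellWeight_nonneg ℓ p x)
      ⟨p, hp, (cellWeight_pos_iff ℓ p x).2 hpx⟩
  let r : E → E := fun x => S.centerMass (fun p => cellWeight ℓ p x) id
  have hrC : ∀ x ∈ V, r x ∈ C := fun x hx =>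
    hC.centerMass_mem (fun p _ => cellWeight_nonneg ℓ p x) (hsum x hx) fun p hp => hSC hp
  have hrcell : ∀ x ∈ V, r x ∈ signCell ℓ x := fun x hx => by
    classical
    have hpos := hsum x hx
    rw [← Finset.sum_filter_ne_zero] at hpos
    change S.centerMass (fun p => cellWeight ℓ p x) id ∈ _
    -- Points of weight zero may lie outside the cell, so they are dropped before convexity is used.
    rw [← Finset.centerMass_filter_ne_zero]
    refine (convex_signCell hconc x).centerMass_mem
      (fun p _ => cellWeight_nonneg ℓ p x) hpos fun p hp => ?_
    exact (cellWeight_pos_iff ℓ p x).1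
      ((cellWeight_nonneg ℓ p x).lt_of_ne' (Finset.mem_filter.1 hp).2)
  have hrcont : Continuous fun x : V => r x := by
    refine Continuous.smul (Continuous.inv₀ ?_ fun x => (hsum x x.2).ne') ?_
    · exact continuous_finsetSum _ fun p _ =>
        (continuous_cellWeight hcont p).comp continuous_subtype_val
    · exact continuous_finsetSum _ fun p _ =>
        ((continuous_cellWeight hcont p).comp continuous_subtype_val).smul continuous_const
  have hseg : ∀ x ∈ V, segment ℝ (r x) x ⊆ V := fun x hx =>
    ((convex_signCell hconc x).segment_subset (hrcell x hx) (mem_signCell_self ℓ x)).trans (hV x hx)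
  let incl : C(↥(V ∩ C), V) := ⟨fun x => ⟨x, x.2.1⟩, by fun_prop⟩
  let ret : C(V, ↥(V ∩ C)) :=
    ⟨fun x => ⟨r x, hV x x.2 (hrcell x x.2), hrC x x.2⟩, hrcont.subtype_mk _⟩
  exact ⟨incl, ret,
    -- For `x` in `C` the segment from `r x` to `x` stays in `C` as well as in `V`, so one formula
    -- serves both homotopies.
    homotopic_of_segment_subset _ _ fun x =>
      Set.subset_inter (hseg x x.2.1) (hC.segment_subset (hrC x x.2.1) x.2.2),
    homotopic_of_segment_subset _ _ fun x => hseg x x.2⟩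

/-! ### Hypersurfaces in terms of real-valued monomials -/

namespace TropicalPolynomial

/-- The value at a point with finite coordinates of a monomial with finite coefficient. -/
noncomputable def realValue {σ : Type*} (f : TropicalPolynomial σ) (e : σ →₀ ℕ) (x : σ → ℝ) : ℝ :=
  -- The default `0` is reached only for `e` outside the support.
  (Tropical.untrop (f.coeff e)).untopD 0 + e.sum fun i m => m * x i

theorem monomialValue_coe {σ : Type*} (f : TropicalPolynomial σ) (x : σ → ℝ) {e : σ →₀ ℕ}
    (he : e ∈ f.support) :
    f.monomialValue (fun i => (x i : WithTop ℝ)) e = (f.realValue e x : WithTop ℝ) := by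
  have hc : Tropical.untrop (f.coeff e) ≠ ⊤ := fun h =>
    MvPolynomial.mem_support_iff.1 he (Tropical.untrop_injective h)
  obtain ⟨c, hc⟩ := WithTop.ne_top_iff_exists.1 hc
  rw [monomialValue, realValue, ← hc, WithTop.untopD_coe, WithTop.coe_add, Finsupp.sum,
    Finsupp.sum, WithTop.coe_sum]
  congr 1
  refine Finset.sum_congr rfl fun i _ => ?_
  rw [← nsmul_eq_mul, WithTop.coe_nsmul]

/-- At a finite point every monomial of the support is finite, so the all-infinite alternative can
hold only for an empty support. -/
theorem mem_hypersurface_iff {σ : Type*} (f : TropicalPolynomial σ) (x : σ → ℝ) :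
    x ∈ f.hypersurface ↔ f.support = ∅ ∨ ∃ e₁ ∈ f.support, ∃ e₂ ∈ f.support, e₁ ≠ e₂ ∧
      f.realValue e₁ x = f.realValue e₂ x ∧ ∀ e ∈ f.support, f.realValue e₁ x ≤ f.realValue e x := by
  refine or_congr ?_ ?_
  · rw [Finset.eq_empty_iff_forall_notMem]
    refine forall_congr' fun e => ⟨fun h he => ?_, fun h he => absurd he h⟩
    have := h he
    rw [monomialValue_coe f x he] at this
    exact WithTop.coe_ne_top this
  · refine exists_congr fun e₁ => and_congr_right fun h₁ => exists_congr fun e₂ =>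
      and_congr_right fun h₂ => and_congr_right fun _ => ?_
    rw [monomialValue_coe f x h₁, monomialValue_coe f x h₂]
    simp only [ne_eq, WithTop.coe_ne_top, not_false_eq_true, true_and, WithTop.coe_inj]
    refine and_congr_right fun _ => forall₂_congr fun e he => ?_
    rw [monomialValue_coe f x he, WithTop.coe_le_coe]

theorem continuous_realValue {σ : Type*} (f : TropicalPolynomial σ) (e : σ →₀ ℕ) :
    Continuous (f.realValue e) := by
  unfold realValue Finsupp.sum
  fun_prop

theorem realValue_combo {σ : Type*} (f : TropicalPolynomial σ) (e : σ →₀ ℕ) (x y : σ → ℝ)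
    {a b : ℝ} (hab : a + b = 1) :
    f.realValue e (a • x + b • y) = a * f.realValue e x + b * f.realValue e y := by
  have h : (e.sum fun i m => (m : ℝ) * (a • x + b • y) i) =
      a * (e.sum fun i m => (m : ℝ) * x i) + b * (e.sum fun i m => (m : ℝ) * y i) := by
    simp only [Finsupp.sum, Finset.mul_sum, ← Finset.sum_add_distrib]
    refine Finset.sum_congr rfl fun i _ => ?_
    simp only [Pi.add_apply, Pi.smul_apply, smul_eq_mul]
    ring
  rw [realValue, realValue, realValue, h]
  linear_combination -(Tropical.untrop (f.coeff e)).untopD 0 * hab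

theorem isClosed_hypersurface {σ : Type*} (f : TropicalPolynomial σ) :
    IsClosed f.hypersurface := by
  have h : f.hypersurface = {_x | f.support = ∅} ∪ ⋃ e₁ ∈ f.support, ⋃ e₂ ∈ f.support,
      {x | e₁ ≠ e₂} ∩ ({x | f.realValue e₁ x = f.realValue e₂ x} ∩
        ⋂ e ∈ f.support, {x | f.realValue e₁ x ≤ f.realValue e x}) := by
    ext x
    simp only [mem_hypersurface_iff, Set.mem_union, Set.mem_ofPred_eq, Set.mem_iUnion,
      Set.mem_inter_iff, Set.mem_iInter, exists_prop]
  rw [h]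
  refine isClosed_const.union ?_
  refine f.support.finite_toSet.isClosed_biUnion fun e₁ _ =>
    f.support.finite_toSet.isClosed_biUnion fun e₂ _ => isClosed_const.inter (IsClosed.inter ?_ ?_)
  · exact isClosed_eq (f.continuous_realValue e₁) (f.continuous_realValue e₂)
  · exact isClosed_biInter fun e _ =>
      isClosed_le (f.continuous_realValue e₁) (f.continuous_realValue e)

theorem mem_hypersurface_rename {σ τ : Type*} {g : σ → τ} (hg : Function.Injective g)
    (f : TropicalPolynomial σ) (x : τ → ℝ) :
    x ∈ hypersurface (MvPolynomial.rename g f) ↔ x ∘ g ∈ f.hypersurface := by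
  classical
  have hv : ∀ e, realValue (MvPolynomial.rename g f) (e.mapDomain g) x = f.realValue e (x ∘ g) := by
    intro e
    rw [realValue, realValue, MvPolynomial.coeff_rename_mapDomain g hg,
      Finsupp.sum_mapDomain_index_inj hg]
    rfl
  simp only [mem_hypersurface_iff, MvPolynomial.support_rename_of_injective hg,
    Finset.image_eq_empty, Finset.exists_mem_image, Finset.forall_mem_image, hv,
    (Finsupp.mapDomain_injective hg).ne_iff]

/-! ### Tropical linear polynomials with two or three terms -/

/-- The tropical sum of the monomials with exponents in `T`, where the constant term has the
coefficient `t` and all other coefficients are `0`. -/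
noncomputable def affineSum {σ : Type*} (T : Finset (σ →₀ ℕ)) (t : ℝ) : TropicalPolynomial σ :=
  open Classical in
  ∑ e ∈ T, MvPolynomial.monomial e (Tropical.trop ((if e = 0 then t else 0 : ℝ) : WithTop ℝ))

theorem coeff_affineSum {σ : Type*} {T : Finset (σ →₀ ℕ)} (t : ℝ) {e : σ →₀ ℕ} (he : e ∈ T) :
    open Classical in
    (affineSum T t).coeff e = Tropical.trop ((if e = 0 then t else 0 : ℝ) : WithTop ℝ) := by
  classical
  rw [affineSum, MvPolynomial.coeff_sum]
  simp only [MvPolynomial.coeff_monomial]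
  rw [Finset.sum_eq_single e]
  · rw [if_pos rfl]
  · intro b _ hb
    rw [if_neg hb]
  · exact fun h => absurd he h

theorem support_affineSum {σ : Type*} (T : Finset (σ →₀ ℕ)) (t : ℝ) :
    (affineSum T t).support = T := by
  classical
  ext e
  rw [MvPolynomial.mem_support_iff]
  by_cases he : e ∈ T
  · rw [coeff_affineSum t he]
    simp only [he, iff_true]
    intro h
    exact WithTop.coe_ne_top (Tropical.trop_injective h)
  · simp only [he, iff_false, not_not]
    rw [affineSum, MvPolynomial.coeff_sum]
    refine Finset.sum_eq_zero fun b hb => ?_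
    rw [MvPolynomial.coeff_monomial, if_neg]
    rintro rfl
    exact he hb

theorem realValue_affineSum_zero {σ : Type*} {T : Finset (σ →₀ ℕ)} (t : ℝ) (h0 : 0 ∈ T)
    (x : σ → ℝ) : (affineSum T t).realValue 0 x = t := by
  simp [realValue, coeff_affineSum t h0]

theorem realValue_affineSum_single {σ : Type*} {T : Finset (σ →₀ ℕ)} (t : ℝ) {a : σ}
    (ha : Finsupp.single a 1 ∈ T) (x : σ → ℝ) :
    (affineSum T t).realValue (Finsupp.single a 1) x = x a := by
  simp [realValue, coeff_affineSum t ha]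

open Classical in
/-- The tropical linear polynomial `x_a ⊕ x_b`. -/
noncomputable def binomial {σ : Type*} (a b : σ) : TropicalPolynomial σ :=
  affineSum {Finsupp.single a 1, Finsupp.single b 1} 0

open Classical in
/-- The tropical linear polynomial `x_a ⊕ t`. -/
noncomputable def affineBinomial {σ : Type*} (a : σ) (t : ℝ) : TropicalPolynomial σ :=
  affineSum {Finsupp.single a 1, 0} t

open Classical in
/-- The tropical linear polynomial `x_a ⊕ x_b ⊕ t`. -/
noncomputable def affineTrinomial {σ : Type*} (a b : σ) (t : ℝ) : TropicalPolynomial σ :=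
  affineSum {Finsupp.single a 1, Finsupp.single b 1, 0} t

theorem totalDegree_binomial {σ : Type*} (a b : σ) : (binomial a b).totalDegree = 1 := by
  simp [MvPolynomial.totalDegree, binomial, support_affineSum]

theorem totalDegree_affineBinomial {σ : Type*} (a : σ) (t : ℝ) :
    (affineBinomial a t).totalDegree = 1 := by
  simp [MvPolynomial.totalDegree, affineBinomial, support_affineSum]

theorem totalDegree_affineTrinomial {σ : Type*} (a b : σ) (t : ℝ) :
    (affineTrinomial a b t).totalDegree = 1 := by
  simp [MvPolynomial.totalDegree, affineTrinomial, support_affineSum]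

theorem mem_hypersurface_binomial {σ : Type*} {a b : σ} (hab : a ≠ b) (x : σ → ℝ) :
    x ∈ (binomial a b).hypersurface ↔ x a = x b := by
  have hne : Finsupp.single a 1 ≠ Finsupp.single b 1 := fun h =>
    hab (Finsupp.single_left_injective one_ne_zero h)
  rw [mem_hypersurface_iff, binomial, support_affineSum]
  simp only [Finset.mem_insert, Finset.mem_singleton, exists_eq_or_imp, exists_eq_left,
    forall_eq_or_imp, forall_eq, Finset.insert_ne_empty, false_or, ne_eq, not_true_eq_false,
    false_and, hne, hne.symm, not_false_eq_true, true_and, or_false]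
  rw [realValue_affineSum_single _ (by simp), realValue_affineSum_single _ (by simp)]
  grind

theorem mem_hypersurface_affineBinomial {σ : Type*} (a : σ) (t : ℝ) (x : σ → ℝ) :
    x ∈ (affineBinomial a t).hypersurface ↔ x a = t := by
  have hne : Finsupp.single a 1 ≠ 0 := Finsupp.single_ne_zero.2 one_ne_zero
  rw [mem_hypersurface_iff, affineBinomial, support_affineSum]
  simp only [Finset.mem_insert, Finset.mem_singleton, exists_eq_or_imp, exists_eq_left,
    forall_eq_or_imp, forall_eq, Finset.insert_ne_empty, false_or, ne_eq, not_true_eq_false,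
    false_and, hne, hne.symm, not_false_eq_true, true_and, or_false]
  rw [realValue_affineSum_single _ (by simp), realValue_affineSum_zero _ (by simp)]
  grind

theorem mem_hypersurface_affineTrinomial {σ : Type*} {a b : σ} (hab : a ≠ b) (t : ℝ) (x : σ → ℝ) :
    x ∈ (affineTrinomial a b t).hypersurface ↔
      x a = x b ∧ x a ≤ t ∨ x a = t ∧ t ≤ x b ∨ x b = t ∧ t ≤ x a := by
  have hne : Finsupp.single a 1 ≠ Finsupp.single b 1 := fun h =>
    hab (Finsupp.single_left_injective one_ne_zero h)
  have ha : Finsupp.single a 1 ≠ 0 := Finsupp.single_ne_zero.2 one_ne_zero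
  have hb : Finsupp.single b 1 ≠ 0 := Finsupp.single_ne_zero.2 one_ne_zero
  rw [mem_hypersurface_iff, affineTrinomial, support_affineSum]
  simp only [Finset.mem_insert, Finset.mem_singleton, exists_eq_or_imp, exists_eq_left,
    forall_eq_or_imp, forall_eq, Finset.insert_ne_empty, false_or, ne_eq, not_true_eq_false,
    false_and, hne, hne.symm, ha, ha.symm, hb, hb.symm, not_false_eq_true, true_and, or_false]
  rw [realValue_affineSum_single _ (by simp), realValue_affineSum_single _ (by simp),
    realValue_affineSum_zero _ (by simp)]
  grind

end TropicalPolynomial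

/-! ### Prevarieties as unions of cells -/

open TropicalPolynomial in
theorem isClosed_tropicalPrevariety {σ ι : Type*} [Finite ι] (A : ι → TropicalPolynomial σ) :
    IsClosed (tropicalPrevariety A) :=
  isClosed_iInter fun i => isClosed_hypersurface (A i)

open TropicalPolynomial in
/-- A tropical prevariety is homotopy equivalent to its intersection with any convex set that
contains a certain finite set of points. -/
theorem exists_finset_homotopyEquiv_tropicalPrevariety {σ ι : Type*} [Finite ι]
    (A : ι → TropicalPolynomial σ) :
    ∃ S : Finset (σ → ℝ), ∀ C : Set (σ → ℝ), Convex ℝ C → ↑S ⊆ C →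
      Nonempty (ContinuousMap.HomotopyEquiv ↥(tropicalPrevariety A ∩ C)
        ↥(tropicalPrevariety A)) := by
  -- Both orders of each pair of monomials occur, so the cell of `x` preserves equalities as well as
  -- inequalities; hence ties and minimality persist on it.
  let ℓ : (Σ i, (A i).support × (A i).support) → (σ → ℝ) → ℝ := fun j x =>
    (A j.1).realValue j.2.2 x - (A j.1).realValue j.2.1 x
  refine exists_finset_homotopyEquiv_inter_convex (ℓ := ℓ) (fun j => ?_) (fun j => ?_) ?_
  · exact (continuous_realValue _ _).sub (continuous_realValue _ _)
  · refine ⟨convex_univ, fun x _ y _ a b _ _ hab => le_of_eq ?_⟩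
    simp only [ℓ, realValue_combo _ _ x y hab, smul_eq_mul]
    ring
  · intro x hx z hz
    refine Set.mem_iInter.2 fun i => ?_
    have hle : ∀ e₁ ∈ (A i).support, ∀ e₂ ∈ (A i).support,
        (A i).realValue e₁ x ≤ (A i).realValue e₂ x →
          (A i).realValue e₁ z ≤ (A i).realValue e₂ z := fun e₁ h₁ e₂ h₂ h =>
      sub_nonneg.1 (hz ⟨i, ⟨e₁, h₁⟩, ⟨e₂, h₂⟩⟩ (sub_nonneg.2 h))
    rw [mem_hypersurface_iff]
    refine ((mem_hypersurface_iff _ _).1 (Set.mem_iInter.1 hx i)).imp_right ?_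
    rintro ⟨e₁, h₁, e₂, h₂, hne, heq, hmin⟩
    exact ⟨e₁, h₁, e₂, h₂, hne,
      (hle e₁ h₁ e₂ h₂ heq.le).antisymm (hle e₂ h₂ e₁ h₁ heq.ge),
      fun e he => hle e₁ h₁ e he (hmin e he)⟩

/-! ### Cutting out the cube with linear polynomials -/

theorem centeredCube_eq_Icc (n : ℕ) (s : ℝ) :
    centeredCube n s = Set.Icc (fun _ => -s) (fun _ => s) := by
  ext x
  simp only [centeredCube, Set.mem_ofPred_eq, Set.mem_Icc, Pi.le_def, forall_and]

theorem exists_subset_centeredCube {n : ℕ} (S : Finset (Fin n → ℝ)) :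
    ∃ s : ℝ, 0 < s ∧ ↑S ⊆ centeredCube n s := by
  obtain ⟨s, hs, h⟩ := S.finite_toSet.isBounded.exists_pos_norm_le
  exact ⟨s, hs, fun x hx i => abs_le.1 ((norm_le_pi_norm x i).trans (h x hx))⟩

open TropicalPolynomial in
/-- The polynomials `x_i ⊕ y_i`, `x_i ⊕ y_i ⊕ s`, `z_i ⊕ (-s)` and `x_i ⊕ z_i ⊕ (-s)`, where
`y_i` and `z_i` are the two new variables belonging to `x_i`. -/
noncomputable def cubePolynomial (n : ℕ) (s : ℝ) (c : Fin 4) (i : Fin n) :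
    TropicalPolynomial (Fin n ⊕ Fin (2 * n)) :=
  ![binomial (Sum.inl i) (Sum.inr (finProdFinEquiv (0, i))),
    affineTrinomial (Sum.inl i) (Sum.inr (finProdFinEquiv (0, i))) s,
    affineBinomial (Sum.inr (finProdFinEquiv (1, i))) (-s),
    affineTrinomial (Sum.inl i) (Sum.inr (finProdFinEquiv (1, i))) (-s)] c

open TropicalPolynomial in
theorem totalDegree_cubePolynomial (n : ℕ) (s : ℝ) (c : Fin 4) (i : Fin n) :
    (cubePolynomial n s c i).totalDegree = 1 := by
  fin_cases c
  · exact totalDegree_binomial _ _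
  · exact totalDegree_affineTrinomial _ _ _
  · exact totalDegree_affineBinomial _ _
  · exact totalDegree_affineTrinomial _ _ _

open TropicalPolynomial in
-- The two binomials force `y_i = x_i` and `z_i = -s`. Given the first, a tie for the minimum of
-- `x_i, y_i, s` means `x_i ≤ s`; given the second, a tie for the minimum of `x_i, z_i, -s` means
-- `-s ≤ x_i`.
theorem forall_mem_hypersurface_cubePolynomial {n : ℕ} (s : ℝ) (i : Fin n)
    (w : Fin n ⊕ Fin (2 * n) → ℝ) :
    (∀ c, w ∈ (cubePolynomial n s c i).hypersurface) ↔
      (-s ≤ w (Sum.inl i) ∧ w (Sum.inl i) ≤ s) ∧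
        w (Sum.inr (finProdFinEquiv (0, i))) = w (Sum.inl i) ∧
        w (Sum.inr (finProdFinEquiv (1, i))) = -s := by
  simp only [Fin.forall_fin_succ, Fin.forall_fin_zero]
  simp only [cubePolynomial, Fin.isValue, Matrix.cons_val_zero, Matrix.cons_val_succ, and_true]
  rw [mem_hypersurface_binomial Sum.inl_ne_inr, mem_hypersurface_affineTrinomial Sum.inl_ne_inr,
    mem_hypersurface_affineBinomial, mem_hypersurface_affineTrinomial Sum.inl_ne_inr]
  grind

/-- The point over `x` of the prevariety that lies over the cube. -/
noncomputable def cubeLift (n : ℕ) (s : ℝ) (x : Fin n → ℝ) : Fin n ⊕ Fin (2 * n) → ℝ :=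
  Sum.elim x fun j => if (finProdFinEquiv.symm j).1 = 0 then x (finProdFinEquiv.symm j).2 else -s

theorem continuous_cubeLift (n : ℕ) (s : ℝ) : Continuous (cubeLift n s) := by
  refine continuous_pi fun v => ?_
  rcases v with i | j
  · exact continuous_apply i
  · simp only [cubeLift, Sum.elim_inr]
    split_ifs
    · exact continuous_apply _
    · exact continuous_const

open TropicalPolynomial in
-- This exhibits the extended prevariety as the graph over `V ∩ [-s, s]^n` of the new coordinates of
-- `cubeLift`, from which the homeomorphism is read off.
theorem mem_tropicalPrevariety_extendedSystem_cubePolynomial {n k : ℕ}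
    (A : Fin k → TropicalPolynomial (Fin n)) (s : ℝ) (w : Fin n ⊕ Fin (2 * n) → ℝ) :
    w ∈ tropicalPrevariety (extendedSystem A fun j : Fin (4 * n) =>
        cubePolynomial n s (finProdFinEquiv.symm j).1 (finProdFinEquiv.symm j).2) ↔
      w ∘ Sum.inl ∈ tropicalPrevariety A ∩ centeredCube n s ∧ w = cubeLift n s (w ∘ Sum.inl) := by
  have hlift : w = cubeLift n s (w ∘ Sum.inl) ↔ ∀ i,
      w (Sum.inr (finProdFinEquiv (0, i))) = w (Sum.inl i) ∧
        w (Sum.inr (finProdFinEquiv (1, i))) = -s := by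
    rw [funext_iff, Sum.forall, ← finProdFinEquiv.forall_congr_right, Prod.forall]
    simp only [cubeLift, Sum.elim_inl, Sum.elim_inr, Equiv.symm_apply_apply, Fin.forall_fin_two,
      Function.comp_apply, implies_true, true_and, forall_and, if_true, one_ne_zero, if_false]
  have hcube : (∀ j : Fin (4 * n), w ∈ (cubePolynomial n s (finProdFinEquiv.symm j).1
      (finProdFinEquiv.symm j).2).hypersurface) ↔
      ∀ i c, w ∈ (cubePolynomial n s c i).hypersurface := by
    rw [← finProdFinEquiv.forall_congr_right, Prod.forall, forall_comm]
    simp only [Equiv.symm_apply_apply]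
  rw [hlift, tropicalPrevariety, Set.mem_iInter, Sum.forall]
  simp only [extendedSystem, Sum.elim_inl, Sum.elim_inr,
    mem_hypersurface_rename Sum.inl_injective, hcube, forall_mem_hypersurface_cubePolynomial,
    forall_and (p := fun i => -s ≤ w (Sum.inl i) ∧ w (Sum.inl i) ≤ s)]
  rw [← and_assoc, tropicalPrevariety, Set.mem_inter_iff, Set.mem_iInter]
  rfl

theorem mainTheorem10 (n k : ℕ) (A : Fin k → TropicalPolynomial (Fin n)) :
    ∃ (G : Fin (4 * n) → TropicalPolynomial (Fin n ⊕ Fin (2 * n))) (s : ℝ),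
      (∀ j, (G j).totalDegree = 1) ∧ 0 < s ∧
      IsCompact (tropicalPrevariety (extendedSystem A G)) ∧
      Nonempty (ContinuousMap.HomotopyEquiv
        ↥(tropicalPrevariety (extendedSystem A G)) ↥(tropicalPrevariety A)) ∧
      ∃ h : ↥(tropicalPrevariety (extendedSystem A G)) ≃ₜ
          ↥(tropicalPrevariety A ∩ centeredCube n s),
        ∀ w i, (h w : Fin n → ℝ) i = (w : Fin n ⊕ Fin (2 * n) → ℝ) (Sum.inl i) := by
  obtain ⟨S, hS⟩ := exists_finset_homotopyEquiv_tropicalPrevariety A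
  obtain ⟨s, hs, hSs⟩ := exists_subset_centeredCube S
  obtain ⟨φ⟩ := hS (centeredCube n s) (centeredCube_eq_Icc n s ▸ convex_Icc _ _) hSs
  have hmem := mem_tropicalPrevariety_extendedSystem_cubePolynomial A s
  refine ⟨fun j => cubePolynomial n s (finProdFinEquiv.symm j).1 (finProdFinEquiv.symm j).2, s,
    fun j => totalDegree_cubePolynomial _ _ _ _, hs, ?_⟩
  -- From here on only the graph description `hmem` of `W` is needed.
  generalize tropicalPrevariety (extendedSystem A fun j : Fin (4 * n) =>
    cubePolynomial n s (finProdFinEquiv.symm j).1 (finProdFinEquiv.symm j).2) = W at hmem ⊢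
  let h : W ≃ₜ ↥(tropicalPrevariety A ∩ centeredCube n s) :=
    { toFun := fun w => ⟨w.1 ∘ Sum.inl, ((hmem w).1 w.2).1⟩
      invFun := fun x => ⟨cubeLift n s x, (hmem _).2 ⟨x.2, rfl⟩⟩
      left_inv := fun w => Subtype.ext ((hmem w).1 w.2).2.symm
      right_inv := fun x => rfl
      continuous_toFun := Continuous.subtype_mk (continuous_pi fun i =>
        (continuous_apply (Sum.inl i)).comp (continuous_subtype_val (p := (· ∈ W)))) _
      continuous_invFun :=
        ((continuous_cubeLift n s).comp continuous_subtype_val).subtype_mk _ }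
  refine ⟨?_, ⟨h.toHomotopyEquiv.trans φ⟩, h, fun w i => rfl⟩
  have hcompact : IsCompact (tropicalPrevariety A ∩ centeredCube n s) :=
    (centeredCube_eq_Icc n s ▸ isCompact_Icc).inter_left (isClosed_tropicalPrevariety A)
  rw [isCompact_iff_compactSpace] at hcompact ⊢
  exact h.symm.compactSpace
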